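/- Let $K=\mathbb F_2$, let $p$ be an odd prime, and let $C\subseteq K^n$ be a self-dual binary linear code of length $n$, i.e. $C=C^\perp$ with respect to the standard scalar product. Let $g$ be an automorphism of $C$ of order $2p$ (a permutation of the $n$ coordinates, of order $2p$, which maps $C$ onto itself), and suppose that the involution $h=g^p$ fixes no coordinate. Number the coordinates in such a way that $h=(1,2)(3,4)\cdots(n-1,n)$, and put $$\phi:C\to K^{n/2},\qquad \phi(c_1,\dots,c_n)=(c_1+c_2,\;c_3+c_4,\;\dots,\;c_{n-1}+c_n).$$ Then $\phi(C)\subseteq\phi(C)^\perp$ in $K^{n/2}$, and a) $\dim_K \phi(C)^\perp/\phi(C)$ is even if $n\equiv 0 \pmod 4$; b) $\dim_K \phi(C)^\perp/\phi(C)$ is odd if $n\equiv 2 \pmod 4$. -/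

import Mathlib

/-- A binary linear code of length `m` (more generally, with coordinates indexed by `ι`):
a linear subspace of `𝔽₂^ι`. -/
abbrev BinCode (ι : Type) : Type := Submodule (ZMod 2) (ι → ZMod 2)

namespace BinCode

/-- The dual code with respect to the standard scalar product `∑ i, x i * y i`. -/
def dual {ι : Type} [Fintype ι] (C : BinCode ι) : BinCode ι :=
  LinearMap.BilinForm.orthogonal (dotProductBilin (ZMod 2) (ZMod 2)) C

theorem mem_dual_iff {ι : Type} [Fintype ι] (C : BinCode ι) (v : ι → ZMod 2) :
    v ∈ C.dual ↔ ∀ c ∈ C, ∑ i, c i * v i = 0 :=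
  Iff.rfl

/-- A code is self-dual if it equals its dual. -/
def IsSelfDual {ι : Type} [Fintype ι] (C : BinCode ι) : Prop := C.dual = C

/-- The coordinate permutation `g` is an automorphism of `C`: it maps the code onto itself. -/
def IsAut {ι : Type} (C : BinCode ι) (g : Equiv.Perm ι) : Prop :=
  ∀ c : ι → ZMod 2, (fun i => c (g i)) ∈ C ↔ c ∈ C

/-- `e` enumerates the `2`-cycles of `h`: the coordinates are numbered by `e` in such a way that
`h = (e (0,0), e (0,1)) (e (1,0), e (1,1)) ⋯`, i.e. after renumbering
`h = (1,2)(3,4)⋯(n-1,n)`. -/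
def EnumeratesTwoCycles {n m : ℕ} (h : Equiv.Perm (Fin n)) (e : Fin m × Fin 2 ≃ Fin n) : Prop :=
  ∀ j : Fin m, h (e (j, 0)) = e (j, 1) ∧ h (e (j, 1)) = e (j, 0)

/-- The map `c ↦ (c₁ + c₂, c₃ + c₄, …)` adding the two coordinates of each pair of the
numbering `e`. -/
def phi {n m : ℕ} (e : Fin m × Fin 2 ≃ Fin n) :
    (Fin n → ZMod 2) →ₗ[ZMod 2] (Fin m → ZMod 2) where
  toFun c := fun j => c (e (j, 0)) + c (e (j, 1))
  map_add' c d := by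
    funext j
    simp only [Pi.add_apply]
    ring
  map_smul' a c := by
    funext j
    simp only [Pi.smul_apply, smul_eq_mul, RingHom.id_apply]
    ring

end BinCode

namespace BinCode

/-! With `h = g ^ p`, one has φ(c)·φ(d) = c·d + c·(d ∘ h). Both terms vanish on C, since h preserves
C = C^⊥; so φ(C) is self-orthogonal. By `finrank_dual_quotient` the quotient has dimension n/2 − 2
dim φ(C), which has the parity of n/2. -/

theorem IsAut.pow {ι : Type} {C : BinCode ι} {g : Equiv.Perm ι} (hg : C.IsAut g) (k : ℕ) :
    C.IsAut (g ^ k) := by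
  induction k with
  | zero => intro c; rfl
  | succ k ih =>
    intro c
    rw [← ih c, ← hg (fun i => c ((g ^ k) i)), pow_succ]
    rfl

/-- Expand each product over a 2-cycle: the diagonal terms form the first sum, the cross terms the
second. -/
theorem sum_phi_mul_phi {n m : ℕ} {h : Equiv.Perm (Fin n)} {e : Fin m × Fin 2 ≃ Fin n}
    (he : EnumeratesTwoCycles h e) (c d : Fin n → ZMod 2) :
    ∑ j, phi e c j * phi e d j = ∑ i, c i * d i + ∑ i, c i * d (h i) := by
  rw [← e.sum_comp (fun i => c i * d i), ← e.sum_comp (fun i => c i * d (h i)),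
    Fintype.sum_prod_type, Fintype.sum_prod_type, ← Finset.sum_add_distrib]
  refine Finset.sum_congr rfl fun j _ => ?_
  simp only [phi, LinearMap.coe_mk, AddHom.coe_mk, Fin.sum_univ_two, (he j).1, (he j).2]
  ring

theorem map_phi_le_dual {n m : ℕ} {C : BinCode (Fin n)} (hC : C.IsSelfDual)
    {h : Equiv.Perm (Fin n)} (hh : C.IsAut h) {e : Fin m × Fin 2 ≃ Fin n}
    (he : EnumeratesTwoCycles h e) : C.map (phi e) ≤ dual (C.map (phi e)) := by
  have key : ∀ c ∈ C, ∀ d ∈ C, ∑ i, c i * d i = 0 := fun c hc d hd =>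
    (mem_dual_iff C d).1 (hC.symm ▸ hd) c hc
  rintro _ ⟨d, hd, rfl⟩
  rw [mem_dual_iff]
  rintro _ ⟨c, hc, rfl⟩
  rw [sum_phi_mul_phi he, key c hc d hd, key c hc _ ((hh d).2 hd), add_zero]

theorem finrank_dual {ι : Type} [Fintype ι] (C : BinCode ι) :
    Module.finrank (ZMod 2) C.dual + Module.finrank (ZMod 2) C = Fintype.card ι := by
  classical
  have hnd : (dotProductBilin (ZMod 2) (ZMod 2) :
      LinearMap.BilinForm (ZMod 2) (ι → ZMod 2)).Nondegenerate :=
    ⟨fun v hv => dotProduct_eq_zero v hv,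
      fun v hv => dotProduct_eq_zero v fun w => (dotProduct_comm v w).trans (hv w)⟩
  have := LinearMap.BilinForm.finrank_orthogonal hnd C
  -- The formula for the orthogonal's dimension uses truncated subtraction; this bound makes it
  -- exact.
  have hle := C.finrank_le
  rw [Module.finrank_pi] at this hle
  unfold dual
  omega

theorem finrank_dual_quotient {ι : Type} [Fintype ι] {C : BinCode ι} (hC : C ≤ C.dual) :
    Module.finrank (ZMod 2) (C.dual ⧸ C.comap C.dual.subtype) + 2 * Module.finrank (ZMod 2) C =
      Fintype.card ι := by
  have h1 := (C.comap C.dual.subtype).finrank_quotient_add_finrank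
  have h2 := (Submodule.comapSubtypeEquivOfLe hC).finrank_eq
  have h3 := C.finrank_dual
  omega

end BinCode

theorem mainTheorem11 (n p : ℕ) (hp : p.Prime) (hp_odd : Odd p)
    (C : BinCode (Fin n)) (hC : C.IsSelfDual)
    (g : Equiv.Perm (Fin n)) (hg : C.IsAut g) (hg_order : orderOf g = 2 * p)
    (hfree : ∀ i : Fin n, (g ^ p) i ≠ i)
    (e : Fin (n / 2) × Fin 2 ≃ Fin n) (he : BinCode.EnumeratesTwoCycles (g ^ p) e) :
    let phiC : BinCode (Fin (n / 2)) := Submodule.map (BinCode.phi e) C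
    phiC ≤ phiC.dual ∧
    (n ≡ 0 [MOD 4] →
      Even (Module.finrank (ZMod 2) (phiC.dual ⧸ Submodule.comap phiC.dual.subtype phiC))) ∧
    (n ≡ 2 [MOD 4] →
      Odd (Module.finrank (ZMod 2) (phiC.dual ⧸ Submodule.comap phiC.dual.subtype phiC))) := by
  intro phiC
  have hle : phiC ≤ phiC.dual := BinCode.map_phi_le_dual hC (hg.pow p) he
  have hrank := BinCode.finrank_dual_quotient hle
  rw [Fintype.card_fin] at hrank
  refine ⟨hle, fun hn => ?_, fun hn => ?_⟩
  · rw [Nat.even_iff]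
    unfold Nat.ModEq at hn
    omega
  · rw [Nat.odd_iff]
    unfold Nat.ModEq at hn
    omega
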